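/- A geometric lattice is a finite lattice that is atomistic (every element is a join of atoms) and upper semimodular. For an element $F$ of such a lattice $L$, with minimum $\bot$ and maximum $\top$, let $\operatorname{rank}(F)$ be the length of a longest chain from $\bot$ to $F$; the rank of $L$ is $\operatorname{rank}(\top)$, and $L_i=\{F\in L:\operatorname{rank}(F)=i\}$. The Chow ring of $L$ is $$A(L)=\mathbb{Z}[x_F : F\in L\setminus\{\bot\}]/(I_1+I_2),$$ where $I_1$ is the ideal generated by the products $x_Fx_G$ with $F,G$ incomparable, and $I_2$ is the ideal generated by the linear forms $\sum_{F\ge a}x_F$ with $a$ an atom of $L$. It is graded with every $x_F$ in degree $1$; its Hilbert series is $H(A(L),t)=\sum_{d\ge 0}\operatorname{rank}_{\mathbb Z}(A(L)_d)\,t^d$. Write $[n]_t=1+t+\cdots+t^{n-1}$. Proposition. Let $r\ge 0$ and let $L$ be a geometric lattice of rank $r+1$ such that $[Z,\top]\cong[Z',\top]$ for all $Z,Z'\in L$ with $\operatorname{rank}(Z)=\operatorname{rank}(Z')$. Let $(Z_1,\dots,Z_r)$ be a sequence of elements of $L$ with $\operatorname{rank}(Z_i)=i$ for all $i$. Then $$H(A(L),t)=[r+1]_t+t\sum_{i=2}^{r}|L_i|\,[i-1]_t\,H(A([Z_i,\top]),t).$$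 -/

import Mathlib

noncomputable section

namespace ChowLattice

open MvPolynomial

/-- The index set of the variables `x_F` of the Chow ring: the elements of `L` other than `⊥`. -/
abbrev Var (L : Type*) [PartialOrder L] [OrderBot L] : Type _ := {F : L // F ≠ ⊥}

/-- The quadratic generators `x_F x_G`, for `F` and `G` incomparable. -/
def quadGens (L : Type*) [PartialOrder L] [OrderBot L] : Set (MvPolynomial (Var L) ℤ) :=
  {p | ∃ F G : Var L, ¬ F ≤ G ∧ ¬ G ≤ F ∧ p = X F * X G}

/-- The linear form `∑_{F ≥ a} x_F`, where `F` runs over the elements of `L` other than `⊥`. -/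
def linForm {L : Type*} [PartialOrder L] [OrderBot L] [Finite L] (a : L) :
    MvPolynomial (Var L) ℤ :=
  ∑ F ∈ (Set.toFinite {F : Var L | a ≤ F.1}).toFinset, X F

/-- The linear generators `∑_{F ≥ a} x_F`, for `a` an atom. -/
def linGens (L : Type*) [PartialOrder L] [OrderBot L] [Finite L] :
    Set (MvPolynomial (Var L) ℤ) :=
  {p | ∃ a : L, IsAtom a ∧ p = linForm a}

/-- The ideal `I₁ + I₂` of relations of the Chow ring. -/
def chowIdeal (L : Type*) [PartialOrder L] [OrderBot L] [Finite L] :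
    Ideal (MvPolynomial (Var L) ℤ) :=
  Ideal.span (quadGens L) ⊔ Ideal.span (linGens L)

attribute [local instance] MvPolynomial.gradedAlgebra

/-- The ideal of relations is homogeneous, so the Chow ring inherits the grading by degree. -/
theorem chowIdeal_isHomogeneous (L : Type*) [PartialOrder L] [OrderBot L] [Finite L] :
    (chowIdeal L).IsHomogeneous (homogeneousSubmodule (Var L) ℤ) := by
  refine Ideal.IsHomogeneous.sup (Ideal.homogeneous_span _ _ ?_) (Ideal.homogeneous_span _ _ ?_)
  · rintro _ ⟨F, G, -, -, rfl⟩
    exact ⟨1 + 1, (isHomogeneous_X ℤ F).mul (isHomogeneous_X ℤ G)⟩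
  · rintro _ ⟨a, -, rfl⟩
    exact ⟨1, IsHomogeneous.sum _ _ _ fun F _ => isHomogeneous_X ℤ F⟩

/-- The Chow ring `A(L) = ℤ[x_F : F ∈ L \ {⊥}] / (I₁ + I₂)`. -/
abbrev ChowRing (L : Type*) [PartialOrder L] [OrderBot L] [Finite L] : Type _ :=
  MvPolynomial (Var L) ℤ ⧸ chowIdeal L

/-- The degree-`d` homogeneous component of the Chow ring, every variable having degree `1`. -/
def component (L : Type*) [PartialOrder L] [OrderBot L] [Finite L] (d : ℕ) :
    Submodule ℤ (ChowRing L) :=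
  (homogeneousSubmodule (Var L) ℤ d).map (Ideal.Quotient.mkₐ ℤ (chowIdeal L)).toLinearMap

/-- The Hilbert series `H(A(L), t) = ∑_d rank_ℤ(A(L)_d) t^d`. -/
def hilbertSeries (L : Type*) [PartialOrder L] [OrderBot L] [Finite L] : PowerSeries ℤ :=
  PowerSeries.mk fun d => (Module.finrank ℤ (component L d) : ℤ)

/-- The `t`-analogue `[n]_t = 1 + t + ⋯ + t^(n-1)`. -/
def tNumber (n : ℕ) : PowerSeries ℤ :=
  ∑ j ∈ Finset.range n, PowerSeries.X ^ j

/-- The set `L_i` of elements of rank `i`; the rank of `F` is the length of a longest chain from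
`⊥` to `F`. -/
def level (L : Type*) [PartialOrder L] (i : ℕ) : Set L :=
  {F | Order.height F = (i : ℕ∞)}

end ChowLattice

end

/-! The Chow ring is built like an iterated blow-up, one variable at a time. List the elements other
than `⊥` along a linear extension; each tail of the list is an upper set. To a tail attach the ring
`R` with one variable per listed element and the relations `filtIdeal`. These include powers of the
forms `∑_{G ≥ F} x_G`: the atoms enter the list last, so the linear relations of the Chow ring
cannot generate the earlier rings. The empty list gives `ℤ`, the full list gives `A(L)`.

Let `z` be the next element, `n = rk z`, `p = ∑_{G > z} x_G` and `y = x_z + p`. Passing to the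
longer list adjoins `x_z` with `x_z J = 0` and `y ^ n = 0`, where `R / J ≅ A([z, ⊤])`
(`quotientSeries_centerIdeal`). Since `p ^ n J = 0` in `R` (`pow_mul_mem_filtIdeal`), the new ring
is additively `R ⊕ ⨁_{0 < i < n} (R / J) y ^ i` (`truncIdeal`, `quotientSeries_comap_truncIdeal`).
So the Hilbert series grows by `t [n - 1]_t H(A([z, ⊤]))` (`quotientSeries_filtIdeal_succ`).

Summing over the list gives `H(A(L)) = 1 + ∑_{F ≠ ⊥} t [rk F - 1]_t H(A([F, ⊤]))`. Group by rank:
rank 1 contributes nothing, `⊤` contributes `t [r]_t`, which with the `1` makes `[r + 1]_t`. -/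

namespace ChowLattice

open MvPolynomial

/-! ### Rank function of a finite upper semimodular lattice. -/

section Rank

variable {L : Type*} [Lattice L]

/-- `b` is reached from `a` by `k` successive covers. -/
def CoverChain : ℕ → L → L → Prop
  | 0, a, b => a = b
  | k + 1, a, b => ∃ c, a ⋖ c ∧ CoverChain k c b

theorem CoverChain.le : ∀ {k : ℕ} {a b : L}, CoverChain k a b → a ≤ b
  | 0, _, _, h => le_of_eq h
  | _ + 1, _, _, ⟨_, hc, h⟩ => hc.le.trans h.le

theorem CoverChain.trans_covBy : ∀ {k : ℕ} {a b c : L}, CoverChain k a b → b ⋖ c →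
    CoverChain (k + 1) a c
  | 0, _, _, c, h, hc => ⟨c, by rw [show _ = _ from h]; exact hc, rfl⟩
  | _ + 1, _, _, _, ⟨d, hd, h⟩, hc => ⟨d, hd, h.trans_covBy hc⟩

theorem CoverChain.height_add_le : ∀ {k : ℕ} {a b : L}, CoverChain k a b →
    Order.height a + k ≤ Order.height b
  | 0, _, _, h => by rw [show _ = _ from h]; simp
  | k + 1, a, b, ⟨c, hc, h⟩ => by
    refine le_trans ?_ h.height_add_le
    have := Order.height_add_one_le hc.lt
    push_cast
    rw [add_comm (k : ℕ∞), ← add_assoc]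
    gcongr

theorem exists_coverChain [Finite L] {a b : L} (hab : a ≤ b) : ∃ k, CoverChain k a b := by
  induction a using WellFoundedGT.induction with
  | _ a ih =>
    rcases hab.eq_or_lt with rfl | h
    · exact ⟨0, rfl⟩
    · obtain ⟨c, hc, hcb⟩ := exists_covBy_le_of_lt h
      obtain ⟨k, hk⟩ := ih c hc.lt hcb
      exact ⟨k + 1, c, hc, hk⟩

/-- The Jordan–Dedekind chain condition. -/
theorem CoverChain.length_unique [IsUpperModularLattice L] [Finite L] :
    ∀ {k : ℕ} {a b : L}, CoverChain k a b → ∀ {m : ℕ}, CoverChain m a b → m = k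
  | 0, _, _, h, 0, _ => rfl
  | 0, _, _, h, _ + 1, ⟨_, hc, h'⟩ => by
    rw [show _ = _ from h] at hc
    exact absurd h'.le hc.lt.not_ge
  | _ + 1, _, _, ⟨_, hc, h'⟩, 0, h => by
    rw [show _ = _ from h] at hc
    exact absurd h'.le hc.lt.not_ge
  | k + 1, a, b, ⟨c, hc, h⟩, m + 1, ⟨d, hd, h'⟩ => by
    rcases eq_or_ne c d with rfl | hne
    · rw [h.length_unique h']
    · have hinf : c ⊓ d = a := by
        refine le_antisymm ?_ (le_inf hc.le hd.le)
        by_contra hlt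
        have h1 : a < c ⊓ d := lt_of_le_not_ge (le_inf hc.le hd.le) hlt
        have h2 : c ⊓ d = c := (hc.eq_or_eq h1.le inf_le_left).resolve_left h1.ne'
        have h3 : c ⊓ d = d := (hd.eq_or_eq h1.le inf_le_right).resolve_left h1.ne'
        exact hne (h2.symm.trans h3)
      have hd' : d ⋖ c ⊔ d := IsUpperModularLattice.covBy_sup_of_inf_covBy (by rwa [hinf])
      have hc' : c ⋖ c ⊔ d := by
        rw [sup_comm]
        exact IsUpperModularLattice.covBy_sup_of_inf_covBy (by rwa [inf_comm, hinf])
      -- Both given chains are compared with chains through `c ⊔ d`, which covers `c` and `d`.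
      obtain ⟨j, hj⟩ := exists_coverChain (sup_le h.le h'.le)
      have e : j + 1 = k := h.length_unique (m := j + 1) ⟨_, hc', hj⟩
      subst e
      rw [CoverChain.length_unique (k := j + 1) (a := d) ⟨_, hd', hj⟩ h']

/-- In a finite upper semimodular lattice the height is a rank function. -/
theorem exists_rank (L : Type*) [Lattice L] [OrderBot L] [Finite L] [IsUpperModularLattice L] :
    ∃ rk : L → ℕ, (∀ x, Order.height x = rk x) ∧ ∀ a b, a ⋖ b → rk b = rk a + 1 := by
  choose rk hrk using fun x : L => exists_coverChain (bot_le (a := x))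
  have hcov : ∀ a b, a ⋖ b → rk b = rk a + 1 := fun a b h =>
    ((hrk a).trans_covBy h).length_unique (hrk b)
  have hmono : StrictMono rk := by
    intro a b hab
    have key : ∀ {k : ℕ} {a b : L}, CoverChain k a b → rk b = rk a + k := by
      intro k
      induction k with
      | zero => rintro a b h; rw [show a = b from h]; rfl
      | succ k ih =>
        rintro a b ⟨c, hc, h⟩
        rw [ih h, hcov _ _ hc]; ring
    obtain ⟨k, hk⟩ := exists_coverChain hab.le
    cases k with
    | zero => exact absurd hk hab.ne
    | succ k => rw [key hk]; omega
  refine ⟨rk, fun x => le_antisymm ?_ ?_, hcov⟩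
  · simpa using Order.height_le_height_apply_of_strictMono rk hmono x
  · simpa using (hrk x).height_add_le

variable {rk : L → ℕ}

/-- Joining with `z` raises the rank less the higher one starts: along a cover `x ⋖ c`, the join
with `z` grows by at most one. Taking `x = y ⊓ z` gives the usual submodular inequality. -/
theorem rank_sup_add_rank_le [Finite L] [IsUpperModularLattice L]
    (hcov : ∀ a b : L, a ⋖ b → rk b = rk a + 1) {x y : L} (hxy : x ≤ y) (z : L) :
    rk (y ⊔ z) + rk x ≤ rk (x ⊔ z) + rk y := by
  induction x using WellFoundedGT.induction with
  | _ x ih =>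
    rcases hxy.eq_or_lt with rfl | h
    · exact le_rfl
    · obtain ⟨c, hc, hcy⟩ := exists_covBy_le_of_lt h
      have h1 := ih c hc.lt hcy
      have h2 : rk (c ⊔ z) ≤ rk (x ⊔ z) + 1 := by
        by_cases hcz : c ≤ x ⊔ z
        · rw [show c ⊔ z = x ⊔ z from le_antisymm (sup_le hcz le_sup_right)
            (sup_le_sup_right hc.le z)]
          omega
        · have hinf : c ⊓ (x ⊔ z) = x :=
            (hc.eq_or_eq (le_inf hc.le le_sup_left) inf_le_left).resolve_right
              fun h => hcz (inf_eq_left.mp h)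
          have : x ⊔ z ⋖ c ⊔ (x ⊔ z) :=
            IsUpperModularLattice.covBy_sup_of_inf_covBy (by rwa [hinf])
          rw [← sup_assoc, sup_eq_left.mpr hc.le] at this
          rw [hcov _ _ this]
      have h3 := hcov _ _ hc
      omega

theorem rank_strictMono [Finite L] (hcov : ∀ a b : L, a ⋖ b → rk b = rk a + 1) :
    StrictMono rk := by
  intro x y hxy
  induction x using WellFoundedGT.induction with
  | _ x ih =>
    obtain ⟨c, hc, hcy⟩ := exists_covBy_le_of_lt hxy
    have h3 := hcov _ _ hc
    rcases hcy.eq_or_lt with rfl | h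
    · omega
    · have := ih c hc.lt h
      omega

end Rank

/-! ### Upper intervals of a geometric lattice are geometric. -/

section UpperInterval

variable {L : Type*} [Lattice L]

theorem Ici_covBy_iff {z : L} {a b : Set.Ici z} : a ⋖ b ↔ a.1 ⋖ b.1 := by
  refine ⟨fun h => ⟨h.lt, fun c hac hcb => ?_⟩, fun h => ⟨h.lt, fun c hac hcb => h.2 hac hcb⟩⟩
  exact h.2 (c := ⟨c, le_trans a.2 hac.le⟩) hac hcb

instance Ici_isUpperModularLattice [IsUpperModularLattice L] (z : L) :
    IsUpperModularLattice (Set.Ici z) where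
  covBy_sup_of_inf_covBy {a b} h := by
    rw [Ici_covBy_iff] at h ⊢
    exact IsUpperModularLattice.covBy_sup_of_inf_covBy h

theorem exists_atom_le_not_le [OrderBot L] [IsAtomistic L] {x y : L} (h : ¬ x ≤ y) :
    ∃ a, IsAtom a ∧ a ≤ x ∧ ¬ a ≤ y := by
  by_contra! hc
  exact h (le_iff_atom_le_imp.mpr hc)

instance Ici_isAtomistic [OrderBot L] [Finite L] [IsAtomistic L] [IsUpperModularLattice L]
    (z : L) : IsAtomistic (Set.Ici z) where
  isLUB_atoms b := by
    refine ⟨{a | IsAtom a ∧ a ≤ b}, ⟨fun a ha => ha.2, fun u hu => ?_⟩, fun a ha => ha.1⟩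
    by_contra hbu
    obtain ⟨a, ha, hab, hau⟩ := exists_atom_le_not_le (x := b.1) (y := u.1) hbu
    -- The atoms of `[z, ⊤]` needed here are the joins `a ⊔ z` with `a` an atom not below `z`.
    have hz : z ⋖ a ⊔ z := by
      refine IsUpperModularLattice.covBy_sup_of_inf_covBy ?_
      rw [((ha.le_iff).mp inf_le_left).resolve_right fun h => hau ((inf_eq_left.mp h).trans u.2)]
      exact bot_covBy_iff.mpr ha
    have := hu (a := ⟨a ⊔ z, le_sup_right⟩)
      ⟨bot_covBy_iff.mp (Ici_covBy_iff.mpr hz), sup_le hab b.2⟩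
    exact hau (le_sup_left.trans this)

end UpperInterval

/-! ### Power relations that hold in the Chow ring. -/

section Relations

section Generators

variable {K : Type*} [PartialOrder K] [OrderBot K] [Finite K]

theorem quad_mem_chowIdeal {F G : Var K} (h₁ : ¬ F ≤ G) (h₂ : ¬ G ≤ F) :
    X F * X G ∈ chowIdeal K :=
  Ideal.mem_sup_left (Ideal.subset_span ⟨F, G, h₁, h₂, rfl⟩)

theorem linForm_mem_chowIdeal {a : K} (ha : IsAtom a) : linForm a ∈ chowIdeal K :=
  Ideal.mem_sup_right (Ideal.subset_span ⟨a, ha, rfl⟩)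

end Generators

variable {K : Type*} [Lattice K] [OrderBot K] [Finite K]

open Classical in
/-- The variable `x_F`, with the convention `x_⊥ = 1`. -/
noncomputable def varOrOne (F : K) : MvPolynomial (Var K) ℤ := if h : F = ⊥ then 1 else X ⟨F, h⟩

theorem varOrOne_mul_X_mem_chowIdeal {Z : K} {Y : Var K} (h₁ : ¬ Z ≤ Y) (h₂ : ¬ Y.1 ≤ Z) :
    varOrOne Z * X Y ∈ chowIdeal K := by
  have hZ : Z ≠ ⊥ := fun h => h₁ (by rw [h]; exact bot_le)
  rw [varOrOne, dif_neg hZ]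
  exact quad_mem_chowIdeal (F := ⟨Z, hZ⟩) h₁ h₂

/-- The relations `x_Z (∑_{G ≥ F} x_G) ^ d = 0`, valid when `d ≥ rank (F ⊔ Z) - rank Z`. -/
theorem varOrOne_mul_linForm_pow_mem_chowIdeal [IsUpperModularLattice K] [IsAtomistic K]
    {rk : K → ℕ} (hcov : ∀ a b : K, a ⋖ b → rk b = rk a + 1) (d : ℕ) :
    ∀ {Z F : K}, ¬ F ≤ Z → rk (F ⊔ Z) ≤ rk Z + d → varOrOne Z * linForm F ^ d ∈ chowIdeal K := by
  induction d with
  | zero =>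
    intro Z F h hrk
    have := rank_strictMono hcov (show Z < F ⊔ Z from right_lt_sup.mpr h)
    omega
  | succ d ih =>
    intro Z F h hrk
    obtain ⟨a, ha, haF, haZ⟩ := exists_atom_le_not_le h
    -- One factor `linForm F` is traded for the relation `linForm a`. An error term `x_Y` has `Y ≥
    -- a`: either `Y ≥ a ⊔ Z > Z`, which lowers the required exponent, or `Y` and `Z` are
    -- incomparable.
    have hsplit : linForm a = linForm F +
        ∑ Y ∈ (Set.toFinite {Y : Var K | a ≤ Y.1 ∧ ¬ F ≤ Y.1}).toFinset, X Y := by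
      classical
      unfold linForm
      rw [← Finset.sum_union]
      · refine Finset.sum_congr ?_ fun _ _ => rfl
        ext Y
        simp only [Set.Finite.mem_toFinset, Set.mem_ofPred_eq, Finset.mem_union]
        constructor
        · intro h; by_cases hF : F ≤ Y.1 <;> simp [h, hF]
        · rintro (h | h)
          exacts [haF.trans h, h.1]
      · rw [Finset.disjoint_left]
        simp +contextual
    have e : varOrOne Z * linForm F ^ (d + 1) = varOrOne Z * linForm F ^ d * linForm a -
        ∑ Y ∈ (Set.toFinite {Y : Var K | a ≤ Y.1 ∧ ¬ F ≤ Y.1}).toFinset,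
          varOrOne Z * linForm F ^ d * X Y := by
      rw [hsplit, ← Finset.mul_sum]; ring
    rw [e]
    refine sub_mem (Ideal.mul_mem_left _ _ (linForm_mem_chowIdeal ha)) (sum_mem fun Y hY => ?_)
    obtain ⟨haY, hFY⟩ : a ≤ Y.1 ∧ ¬ F ≤ Y.1 := by simpa using hY
    by_cases hZY : Z ≤ Y.1
    · have h1 := ih (Z := Y.1) (F := F) hFY ?_
      · rw [varOrOne, dif_neg Y.2] at h1
        rw [show varOrOne Z * linForm F ^ d * X Y = varOrOne Z * (X Y * linForm F ^ d) by ring]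
        exact Ideal.mul_mem_left _ _ h1
      · have h1 := rank_sup_add_rank_le hcov (sup_le_sup_right haF Z) Y.1
        have h2 := rank_strictMono hcov (show Z < a ⊔ Z from right_lt_sup.mpr haZ)
        rw [sup_assoc, sup_eq_right.mpr hZY, sup_assoc, sup_eq_right.mpr hZY,
          sup_eq_right.mpr haY] at h1
        omega
    · rw [show varOrOne Z * linForm F ^ d * X Y = linForm F ^ d * (varOrOne Z * X Y) by ring]
      exact Ideal.mul_mem_left _ _
        (varOrOne_mul_X_mem_chowIdeal hZY fun h => haZ (haY.trans h))

end Relations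

/-! ### Additivity of rank over a domain. -/

section Finrank

variable {R M N : Type*} [CommRing R] [AddCommGroup M] [AddCommGroup N] [Module R M]
  [Module R N]

theorem finrank_eq_of_surjective_of_ker_eq {P : Type*} [AddCommGroup P] [Module R P]
    (f : P →ₗ[R] M) (g : P →ₗ[R] N) (hf : Function.Surjective f) (hg : Function.Surjective g)
    (h : LinearMap.ker f = LinearMap.ker g) : Module.finrank R M = Module.finrank R N :=
  ((f.quotKerEquivOfSurjective hf).symm.trans
    ((Submodule.quotEquivOfEq _ _ h).trans (g.quotKerEquivOfSurjective hg))).finrank_eq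

/-- Rank-nullity replaces freeness, since the graded pieces are not known to be torsion-free. -/
theorem finrank_prod_of_isDomain [IsDomain R] [Module.Finite R M] [Module.Finite R N] :
    Module.finrank R (M × N) = Module.finrank R M + Module.finrank R N := by
  rw [← Submodule.finrank_quotient_add_finrank (LinearMap.ker (LinearMap.fst R M N)),
    ((LinearMap.fst R M N).quotKerEquivOfSurjective LinearMap.fst_surjective).finrank_eq,
    LinearMap.ker_fst,
    (LinearEquiv.ofInjective (LinearMap.inr R M N) LinearMap.inr_injective).finrank_eq.symm]

theorem finrank_pi_fin_of_isDomain [IsDomain R] : ∀ {n : ℕ} (V : Fin n → Type*) [∀ i, AddCommGroup (V i)]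
    [∀ i, Module R (V i)] [∀ i, Module.Finite R (V i)],
    Module.finrank R (∀ i, V i) = ∑ i, Module.finrank R (V i)
  | 0, V, _, _, _ => by
    rw [Finset.univ_eq_empty, Finset.sum_empty]
    exact Module.finrank_zero_of_subsingleton
  | n + 1, V, _, _, _ => by
    rw [← (Fin.consLinearEquiv R V).finrank_eq, finrank_prod_of_isDomain, Fin.sum_univ_succ,
      finrank_pi_fin_of_isDomain fun i : Fin n => V i.succ]

end Finrank

/-! ### Hilbert series of quotients of polynomial rings. -/

section Component

variable {σ τ : Type*}

/-- The degree-`d` component of the quotient of a polynomial ring by an ideal. -/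
noncomputable def gradedPiece (I : Ideal (MvPolynomial σ ℤ)) (d : ℕ) :
    Submodule ℤ (MvPolynomial σ ℤ ⧸ I) :=
  (homogeneousSubmodule σ ℤ d).map (Ideal.Quotient.mkₐ ℤ I).toLinearMap

/-- The Hilbert series of the quotient of a polynomial ring by an ideal. -/
noncomputable def quotientSeries (I : Ideal (MvPolynomial σ ℤ)) : PowerSeries ℤ :=
  PowerSeries.mk fun d => (Module.finrank ℤ (gradedPiece I d) : ℤ)

theorem hilbertSeries_eq_quotientSeries (L : Type*) [PartialOrder L] [OrderBot L] [Finite L] :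
    hilbertSeries L = quotientSeries (chowIdeal L) := rfl

/-- The projection of homogeneous polynomials of degree `d` onto a graded piece of a quotient. -/
noncomputable def toPiece (I : Ideal (MvPolynomial σ ℤ)) (d : ℕ) :
    homogeneousSubmodule σ ℤ d →ₗ[ℤ] gradedPiece I d :=
  (Ideal.Quotient.mkₐ ℤ I).toLinearMap.submoduleMap (homogeneousSubmodule σ ℤ d)

theorem toPiece_surjective (I : Ideal (MvPolynomial σ ℤ)) (d : ℕ) :
    Function.Surjective (toPiece I d) :=
  LinearMap.submoduleMap_surjective _ _

theorem toPiece_eq_zero_iff {I : Ideal (MvPolynomial σ ℤ)} {d : ℕ}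
    {q : homogeneousSubmodule σ ℤ d} : toPiece I d q = 0 ↔ q.1 ∈ I := by
  rw [← Ideal.Quotient.eq_zero_iff_mem]
  exact Subtype.ext_iff

instance gradedPiece_finite [Finite σ] (I : Ideal (MvPolynomial σ ℤ)) (d : ℕ) :
    Module.Finite ℤ (gradedPiece I d) :=
  Module.Finite.iff_fg.mpr ((homogeneousSubmodule_fg σ ℤ d).map _)

theorem quotientSeries_eq_of_comap {I : Ideal (MvPolynomial σ ℤ)} {J : Ideal (MvPolynomial τ ℤ)}
    (f : MvPolynomial σ ℤ →ₐ[ℤ] MvPolynomial τ ℤ)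
    (hf : ∀ d q, IsHomogeneous q d → IsHomogeneous (f q) d)
    (hsurj : ∀ d q, IsHomogeneous q d → ∃ q', IsHomogeneous q' d ∧ f q' = q)
    (hI : I = J.comap f) : quotientSeries I = quotientSeries J := by
  ext d
  simp only [quotientSeries, PowerSeries.coeff_mk]
  congr 1
  let F : homogeneousSubmodule σ ℤ d →ₗ[ℤ] homogeneousSubmodule τ ℤ d :=
    f.toLinearMap.restrict fun q hq => hf d q hq
  refine finrank_eq_of_surjective_of_ker_eq (toPiece I d) (toPiece J d ∘ₗ F)
    (toPiece_surjective I d) ((toPiece_surjective J d).comp ?_) ?_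
  · rintro ⟨q, hq⟩
    obtain ⟨q', h, rfl⟩ := hsurj d q hq
    exact ⟨⟨q', h⟩, rfl⟩
  · ext q
    rw [LinearMap.mem_ker, LinearMap.mem_ker, LinearMap.comp_apply, toPiece_eq_zero_iff,
      toPiece_eq_zero_iff, hI]
    rfl

end Component

/-! ### The change of variable `y = x₀ + p`. -/

section BlowUp

variable {k : ℕ}

/-- The isomorphism `S[x₀] ≃ S[y]` sending `x₀` to `y - p`, as a homomorphism. -/
noncomputable def shiftHom (p : MvPolynomial (Fin k) ℤ) :
    MvPolynomial (Fin (k + 1)) ℤ →ₐ[ℤ] Polynomial (MvPolynomial (Fin k) ℤ) :=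
  aeval (Fin.cons (Polynomial.X - Polynomial.C p) fun i => Polynomial.C (X i))

/-- The inverse of `shiftHom`. -/
noncomputable def unshiftHom (p : MvPolynomial (Fin k) ℤ) :
    Polynomial (MvPolynomial (Fin k) ℤ) →+* MvPolynomial (Fin (k + 1)) ℤ :=
  Polynomial.eval₂RingHom (rename Fin.succ : _ →ₐ[ℤ] _).toRingHom (X 0 + rename Fin.succ p)

variable (p : MvPolynomial (Fin k) ℤ)

@[simp] theorem shiftHom_X_zero : shiftHom p (X 0) = Polynomial.X - Polynomial.C p := by
  simp [shiftHom]

@[simp] theorem shiftHom_rename (q : MvPolynomial (Fin k) ℤ) :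
    shiftHom p (rename Fin.succ q) = Polynomial.C q := by
  have : (shiftHom p).toRingHom.comp (rename Fin.succ : _ →ₐ[ℤ] _).toRingHom =
      Polynomial.C := by
    refine MvPolynomial.ringHom_ext (fun r => by simp) fun i => ?_
    simp [shiftHom]
  exact congrArg (fun f => f q) this

theorem unshiftHom_C (q : MvPolynomial (Fin k) ℤ) :
    unshiftHom p (Polynomial.C q) = rename Fin.succ q := by
  simp [unshiftHom]

theorem unshiftHom_X : unshiftHom p Polynomial.X = X 0 + rename Fin.succ p := by
  simp [unshiftHom]

theorem unshiftHom_shiftHom (q : MvPolynomial (Fin (k + 1)) ℤ) :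
    unshiftHom p (shiftHom p q) = q := by
  have : ((unshiftHom p).comp (shiftHom p).toRingHom) = RingHom.id _ := by
    refine MvPolynomial.ringHom_ext (fun r => by simp) fun i => ?_
    refine Fin.cases ?_ (fun i => ?_) i
    · simp [unshiftHom_C, unshiftHom_X]
    · simp [shiftHom, unshiftHom_C]
  exact congrArg (fun f => f q) this

theorem shiftHom_eq_sum (q : MvPolynomial (Fin (k + 1)) ℤ) {N : ℕ}
    (hN : (shiftHom p q).natDegree < N) :
    q = ∑ i ∈ Finset.range N,
      rename Fin.succ ((shiftHom p q).coeff i) * (X 0 + rename Fin.succ p) ^ i := by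
  conv_lhs => rw [← unshiftHom_shiftHom p q, Polynomial.as_sum_range' _ N hN]
  simp [unshiftHom_C, unshiftHom_X, ← Polynomial.C_mul_X_pow_eq_monomial]

/-- Factoring through a linear substitution reduces degree statements about coefficients in `y` to
those for `finSuccEquiv`. -/
theorem shiftHom_eq_finSuccEquiv (q : MvPolynomial (Fin (k + 1)) ℤ) :
    shiftHom p q = finSuccEquiv ℤ k
      (aeval (Fin.cons (X 0 - rename Fin.succ p) fun i => X i.succ) q) := by
  have hren : ∀ q, finSuccEquiv ℤ k (rename Fin.succ q) = Polynomial.C q := by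
    have : (finSuccEquiv ℤ k).toRingEquiv.toRingHom.comp
        (rename Fin.succ : _ →ₐ[ℤ] _).toRingHom = Polynomial.C := by
      refine MvPolynomial.ringHom_ext (fun r => by simp) fun i => ?_
      simp [finSuccEquiv_X_succ]
    exact fun q => congrArg (fun f => f q) this
  have : shiftHom p = (finSuccEquiv ℤ k).toAlgHom.comp
      (aeval (Fin.cons (X 0 - rename Fin.succ p) fun i => X i.succ)) := by
    refine MvPolynomial.algHom_ext fun i => ?_
    refine Fin.cases ?_ (fun i => ?_) i
    · simp [finSuccEquiv_X_zero, hren]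
    · simp [finSuccEquiv_X_succ, shiftHom]
  rw [this]; rfl

variable {p}

theorem isHomogeneous_shift (hp : p.IsHomogeneous 1) {q : MvPolynomial (Fin (k + 1)) ℤ} {d : ℕ}
    (hq : q.IsHomogeneous d) :
    (aeval (Fin.cons (X 0 - rename Fin.succ p) fun i => X i.succ) q :
      MvPolynomial (Fin (k + 1)) ℤ).IsHomogeneous d := by
  rw [← one_mul d]
  refine hq.aeval _ fun i => ?_
  refine Fin.cases ?_ (fun i => ?_) i
  · exact (isHomogeneous_X ℤ _).sub hp.rename_isHomogeneous
  · exact isHomogeneous_X ℤ _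

theorem shiftHom_coeff_isHomogeneous (hp : p.IsHomogeneous 1)
    {q : MvPolynomial (Fin (k + 1)) ℤ} {d : ℕ} (hq : q.IsHomogeneous d) {i j : ℕ}
    (hij : i + j = d) : ((shiftHom p q).coeff i).IsHomogeneous j := by
  rw [shiftHom_eq_finSuccEquiv]
  exact (isHomogeneous_shift hp hq).finSuccEquiv_coeff_isHomogeneous i j hij

theorem shiftHom_coeff_eq_zero (hp : p.IsHomogeneous 1)
    {q : MvPolynomial (Fin (k + 1)) ℤ} {d : ℕ} (hq : q.IsHomogeneous d) {i : ℕ}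
    (hi : d < i) : (shiftHom p q).coeff i = 0 := by
  rw [shiftHom_eq_finSuccEquiv]
  ext m
  rw [finSuccEquiv_coeff_coeff, coeff_zero]
  refine (isHomogeneous_shift hp hq).coeff_eq_zero ?_
  rw [Finsupp.degree_eq_sum, Fin.sum_univ_succ, Finsupp.cons_zero]
  omega

end BlowUp

/-! ### The ideal of the blow-up in the variable `y`. -/

section TruncIdeal

variable {S : Type*} [CommRing S]

/-- The polynomials in `y` whose truncation below degree `n` has value at `y = p` in `I` and
coefficients of positive degree in `J`. -/
def truncIdeal (I J : Ideal S) (hIJ : I ≤ J) (p : S) (n : ℕ) (hp : ∀ j ∈ J, p ^ n * j ∈ I) :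
    Ideal (Polynomial S) where
  carrier := {f | (∀ i, 0 < i → i < n → f.coeff i ∈ J) ∧
    ∑ i ∈ Finset.range n, f.coeff i * p ^ i ∈ I}
  add_mem' {f g} hf hg := by
    refine ⟨fun i h0 hi => ?_, ?_⟩
    · rw [Polynomial.coeff_add]; exact add_mem (hf.1 i h0 hi) (hg.1 i h0 hi)
    · simp only [Polynomial.coeff_add, add_mul, Finset.sum_add_distrib]
      exact add_mem hf.2 hg.2
  zero_mem' := by simp
  smul_mem' g f hf := by
    have hC : ∀ (a : S) (f : Polynomial S), (∀ i, 0 < i → i < n → f.coeff i ∈ J) ∧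
        ∑ i ∈ Finset.range n, f.coeff i * p ^ i ∈ I →
        (∀ i, 0 < i → i < n → (Polynomial.C a * f).coeff i ∈ J) ∧
        ∑ i ∈ Finset.range n, (Polynomial.C a * f).coeff i * p ^ i ∈ I := by
      intro a f hf
      simp only [Polynomial.coeff_C_mul, mul_assoc, ← Finset.mul_sum]
      exact ⟨fun i h0 hi => J.mul_mem_left _ (hf.1 i h0 hi), I.mul_mem_left _ hf.2⟩
    have hX : ∀ f : Polynomial S, (∀ i, 0 < i → i < n → f.coeff i ∈ J) ∧
        ∑ i ∈ Finset.range n, f.coeff i * p ^ i ∈ I →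
        (∀ i, 0 < i → i < n → (Polynomial.X * f).coeff i ∈ J) ∧
        ∑ i ∈ Finset.range n, (Polynomial.X * f).coeff i * p ^ i ∈ I := by
      intro f hf
      cases n with
      | zero => simp
      | succ m =>
        have hJ : ∀ i < m + 1, f.coeff i ∈ J := by
          intro i hi
          cases i with
          | zero =>
            have h := hIJ hf.2
            rw [Finset.sum_range_succ', pow_zero, mul_one] at h
            refine (Submodule.add_mem_iff_right J (sum_mem fun i hi => ?_)).mp h
            exact J.mul_mem_right _ (hf.1 _ (by omega) (by simpa using hi))
          | succ i => exact hf.1 _ (by omega) hi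
        refine ⟨fun i h0 hi => ?_, ?_⟩
        · obtain ⟨j, rfl⟩ := Nat.exists_eq_succ_of_ne_zero h0.ne'
          rw [Nat.succ_eq_add_one, Polynomial.coeff_X_mul]
          exact hJ j (by omega)
        -- Multiplication by `y` pushes the top coefficient past the truncation; the loss `p ^ n *
        -- f_{n-1}` lies in `I` because `f_{n-1} ∈ J`.
        · have e : ∑ i ∈ Finset.range (m + 1), (Polynomial.X * f).coeff i * p ^ i =
              p * ∑ i ∈ Finset.range (m + 1), f.coeff i * p ^ i - p ^ (m + 1) * f.coeff m := by
            rw [Finset.sum_range_succ', Finset.sum_range_succ, mul_add, Finset.mul_sum]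
            simp only [Polynomial.coeff_X_mul, Polynomial.coeff_X_mul_zero, zero_mul, add_zero]
            rw [pow_succ', show p * (f.coeff m * p ^ m) = p * p ^ m * f.coeff m by ring,
              add_sub_cancel_right]
            exact Finset.sum_congr rfl fun i _ => by ring
          rw [e]
          exact sub_mem (I.mul_mem_left _ hf.2) (hp _ (hJ m (by omega)))
    rw [smul_eq_mul]
    induction g using Polynomial.induction_on' with
    | add g₁ g₂ h₁ h₂ =>
      rw [add_mul]
      refine ⟨fun i h0 hi => ?_, ?_⟩
      · rw [Polynomial.coeff_add]; exact add_mem (h₁.1 i h0 hi) (h₂.1 i h0 hi)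
      · simp only [Polynomial.coeff_add, add_mul, Finset.sum_add_distrib]
        exact add_mem h₁.2 h₂.2
    | monomial m a =>
      rw [← Polynomial.C_mul_X_pow_eq_monomial, mul_assoc]
      refine hC a _ ?_
      induction m with
      | zero => simpa using hf
      | succ m ih => rw [pow_succ', mul_assoc]; exact hX _ ih

variable {I J : Ideal S} {hIJ : I ≤ J} {p : S} {n : ℕ} {hp : ∀ j ∈ J, p ^ n * j ∈ I}

theorem mem_truncIdeal {f : Polynomial S} : f ∈ truncIdeal I J hIJ p n hp ↔
    (∀ i, 0 < i → i < n → f.coeff i ∈ J) ∧ ∑ i ∈ Finset.range n, f.coeff i * p ^ i ∈ I :=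
  Iff.rfl

theorem C_mem_truncIdeal {a : S} (ha : a ∈ I) :
    Polynomial.C a ∈ truncIdeal I J hIJ p n hp := by
  refine ⟨fun i h0 hi => ?_, sum_mem fun i _ => I.mul_mem_right _ ?_⟩
  · rw [Polynomial.coeff_C_of_ne_zero h0.ne']; exact zero_mem _
  · rw [Polynomial.coeff_C]; split_ifs
    exacts [ha, zero_mem _]

theorem X_pow_mem_truncIdeal {d : ℕ} (hd : n ≤ d) :
    (Polynomial.X ^ d : Polynomial S) ∈ truncIdeal I J hIJ p n hp := by
  refine ⟨fun i h0 hi => ?_, sum_mem fun i hi => I.mul_mem_right _ ?_⟩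
  · rw [Polynomial.coeff_X_pow, if_neg (by omega)]; exact zero_mem _
  · rw [Finset.mem_range] at hi
    rw [Polynomial.coeff_X_pow, if_neg (by omega)]; exact zero_mem _

theorem X_sub_C_mul_C_mem_truncIdeal {j : S} (hj : j ∈ J) :
    (Polynomial.X - Polynomial.C p) * Polynomial.C j ∈ truncIdeal I J hIJ p n hp := by
  have hc : ∀ i, 1 < i → ((Polynomial.X - Polynomial.C p) * Polynomial.C j).coeff i = 0 := by
    intro i hi
    rw [Polynomial.coeff_mul_C, Polynomial.coeff_sub, Polynomial.coeff_X_of_ne_one (by omega),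
      Polynomial.coeff_C_of_ne_zero (by omega), sub_zero, zero_mul]
  have h1 : ((Polynomial.X - Polynomial.C p) * Polynomial.C j).coeff 1 = j := by
    simp
  refine ⟨fun i h0 hi => ?_, ?_⟩
  · obtain rfl | h := eq_or_lt_of_le (Nat.succ_le_of_lt h0)
    · rwa [h1]
    · rw [hc i h]; exact zero_mem _
  -- For `n ≥ 2` the two terms cancel at `y = p`. For `n = 1` the linear term is cut off, and `p * j
  -- ∈ I` is the hypothesis itself.
  · match n, hp with
    | 0, _ => simp
    | 1, hp => simpa using hp j hj
    | m + 2, _ =>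
      rw [Finset.sum_range_succ', Finset.sum_range_succ', Finset.sum_eq_zero fun i _ => by
        rw [hc _ (by omega), zero_mul], h1]
      simp [mul_comm p j]

end TruncIdeal

/-! ### Presentation and Hilbert series of the blow-up. -/

section BlowUp

variable {k n : ℕ} {I J : Ideal (MvPolynomial (Fin k) ℤ)} {hIJ : I ≤ J}
  {p : MvPolynomial (Fin k) ℤ} {hpJ : ∀ j ∈ J, p ^ n * j ∈ I}
  {I' : Ideal (MvPolynomial (Fin (k + 1)) ℤ)}

/-- Modulo `y ^ n` only the truncation counts. Its value at `p` lies in `I`, and the rest is a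
combination of `y ^ i - p ^ i`, divisible by `y - p = x₀`, with coefficients in `J`. -/
theorem comap_truncIdeal_le (h₁ : ∀ a ∈ I, rename Fin.succ a ∈ I')
    (h₂ : ∀ j ∈ J, X 0 * rename Fin.succ j ∈ I') (h₃ : (X 0 + rename Fin.succ p) ^ n ∈ I') :
    (truncIdeal I J hIJ p n hpJ).comap (shiftHom p) ≤ I' := by
  intro q hq
  obtain ⟨hJ, hI⟩ := Ideal.mem_comap.mp hq
  rw [shiftHom_eq_sum p q (N := max n ((shiftHom p q).natDegree + 1)) (by omega),
    ← Finset.sum_range_add_sum_Ico _ (le_max_left n _)]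
  refine add_mem ?_ (sum_mem fun i hi => Ideal.mul_mem_left _ _
    (Ideal.pow_mem_of_pow_mem _ h₃ (Finset.mem_Ico.mp hi).1))
  have e : ∑ i ∈ Finset.range n,
      rename Fin.succ ((shiftHom p q).coeff i) * (X 0 + rename Fin.succ p) ^ i =
      rename Fin.succ (∑ i ∈ Finset.range n, (shiftHom p q).coeff i * p ^ i) +
      ∑ i ∈ Finset.range n, rename Fin.succ ((shiftHom p q).coeff i) *
        ((X 0 + rename Fin.succ p) ^ i - rename Fin.succ p ^ i) := by
    rw [map_sum, ← Finset.sum_add_distrib]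
    exact Finset.sum_congr rfl fun i _ => by rw [map_mul, map_pow]; ring
  rw [e]
  refine add_mem (h₁ _ hI) (sum_mem fun i hi => ?_)
  rcases Nat.eq_zero_or_pos i with rfl | h0
  · simp
  · obtain ⟨c, hc⟩ := sub_dvd_pow_sub_pow (X 0 + rename Fin.succ p) (rename Fin.succ p) i
    rw [hc, add_sub_cancel_right, ← mul_assoc, mul_comm (rename _ _) (X 0)]
    exact Ideal.mul_mem_right _ _ (h₂ _ (hJ i h0 (Finset.mem_range.mp hi)))

/-- The value of the truncation at `p` modulo `I`, with the coefficients of `y, …, y ^ (n - 1)`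
modulo `J`, identifies degree `d` of the quotient with a direct sum. -/
theorem quotientSeries_comap_truncIdeal (hn : 0 < n) (hp : p.IsHomogeneous 1) :
    quotientSeries ((truncIdeal I J hIJ p n hpJ).comap (shiftHom p)) =
      quotientSeries I +
        (∑ i ∈ Finset.range (n - 1), PowerSeries.X ^ (i + 1)) * quotientSeries J := by
  ext d
  let c (i : ℕ) : MvPolynomial (Fin (k + 1)) ℤ →ₗ[ℤ] MvPolynomial (Fin k) ℤ :=
    ((Polynomial.lcoeff (MvPolynomial (Fin k) ℤ) i).restrictScalars ℤ) ∘ₗ (shiftHom p).toLinearMap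
  have hc : ∀ i q, c i q = (shiftHom p q).coeff i := fun i q => rfl
  let e : MvPolynomial (Fin (k + 1)) ℤ →ₗ[ℤ] MvPolynomial (Fin k) ℤ :=
    ∑ i ∈ Finset.range n, LinearMap.mulRight ℤ (p ^ i) ∘ₗ c i
  have he : ∀ q, e q = ∑ i ∈ Finset.range n, (shiftHom p q).coeff i * p ^ i := by
    intro q
    simp [e, hc]
  have hedeg : ∀ q, IsHomogeneous q d → IsHomogeneous (e q) d := by
    intro q hq
    rw [he]
    refine IsHomogeneous.sum _ _ _ fun i _ => ?_
    by_cases hi : i ≤ d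
    · have := (shiftHom_coeff_isHomogeneous hp hq (i := i) (j := d - i) (by omega)).mul (hp.pow i)
      rwa [one_mul, Nat.sub_add_cancel hi] at this
    · rw [shiftHom_coeff_eq_zero hp hq (by omega), zero_mul]
      exact isHomogeneous_zero _ _ _
  -- Powers of `y` beyond `d` are left out: there the truncated `d - (i + 1)` would be `0` and
  -- wrongly give a degree-zero piece.
  let m := min (n - 1) d
  let g : homogeneousSubmodule (Fin (k + 1)) ℤ d →ₗ[ℤ]
      gradedPiece I d × ∀ i : Fin m, gradedPiece J (d - (i + 1)) :=
    (toPiece I d ∘ₗ e.restrict hedeg).prod (LinearMap.pi fun i =>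
      toPiece J (d - (i + 1)) ∘ₗ (c (i + 1)).restrict fun q hq =>
        shiftHom_coeff_isHomogeneous hp hq (by have := i.2; omega))
  have hker : LinearMap.ker (toPiece ((truncIdeal I J hIJ p n hpJ).comap (shiftHom p)) d) =
      LinearMap.ker g := by
    ext ⟨q, hq⟩
    have hg : g ⟨q, hq⟩ = 0 ↔ e q ∈ I ∧ ∀ i : Fin m, c (i + 1) q ∈ J := by
      rw [Prod.ext_iff, funext_iff]
      exact and_congr toPiece_eq_zero_iff (forall_congr' fun i => toPiece_eq_zero_iff)
    rw [LinearMap.mem_ker, LinearMap.mem_ker, hg, toPiece_eq_zero_iff, Ideal.mem_comap,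
      mem_truncIdeal, he, and_comm]
    refine and_congr_right fun _ => ⟨fun h i => h _ (by omega) (by have := i.2; omega), ?_⟩
    intro h i h0 hi
    by_cases hid : i ≤ d
    · rw [← hc]
      have := h ⟨i - 1, by omega⟩
      simpa [Nat.sub_add_cancel h0] using this
    · rw [shiftHom_coeff_eq_zero hp hq (by omega)]
      exact zero_mem _
  have hsurj : Function.Surjective g := by
    rintro ⟨a, b⟩
    obtain ⟨⟨a, ha⟩, rfl⟩ := toPiece_surjective _ _ a
    choose b' hb' using fun i => toPiece_surjective _ _ (b i)
    have hX : (X 0 + rename Fin.succ p : MvPolynomial (Fin (k + 1)) ℤ).IsHomogeneous 1 :=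
      (isHomogeneous_X ℤ _).add hp.rename_isHomogeneous
    have hdeg : ∀ i : Fin m, d - (i + 1) + (i + 1) = d := fun i => by have := i.2; omega
    have hey : ∀ s j, j < n →
        e (rename Fin.succ s * (X 0 + rename Fin.succ p) ^ j) = s * p ^ j := by
      intro s j hj
      rw [he]
      simp [Polynomial.coeff_X_pow, hj]
    have hcy : ∀ s i j, c i (rename Fin.succ s * (X 0 + rename Fin.succ p) ^ j) =
        if i = j then s else 0 := by
      intro s i j
      rw [hc]
      simp [Polynomial.coeff_X_pow]
    have hb'd : ∀ i, IsHomogeneous (b' i).1 (d - (i + 1)) := fun i => (b' i).2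
    -- The constant term is corrected so that the value at `y = p` is exactly `a`.
    let q := rename Fin.succ (a - ∑ i, (b' i).1 * p ^ (i.1 + 1)) *
        (X 0 + rename Fin.succ p) ^ 0 +
      ∑ i, rename Fin.succ (b' i).1 * (X 0 + rename Fin.succ p) ^ (i.1 + 1)
    have hq : IsHomogeneous q d := by
      refine IsHomogeneous.add ?_ (IsHomogeneous.sum _ _ _ fun i _ => ?_)
      · rw [pow_zero, mul_one]
        refine IsHomogeneous.rename_isHomogeneous
          (IsHomogeneous.sub ha (IsHomogeneous.sum _ _ _ fun i _ => ?_))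
        have := (hb'd i).mul (hp.pow (i.1 + 1))
        rwa [one_mul, hdeg] at this
      · have := (hb'd i).rename_isHomogeneous (f := Fin.succ) |>.mul (hX.pow (i.1 + 1))
        rwa [one_mul, hdeg] at this
    have heq : e q = a := by
      rw [map_add, map_sum, hey _ _ hn, Finset.sum_congr rfl fun i _ =>
        hey (b' i).1 (i.1 + 1) (by have := i.2; omega)]
      simp
    have hcq : ∀ i : Fin m, c (i + 1) q = (b' i).1 := by
      intro i
      rw [map_add, map_sum, hcy, if_neg (by omega), zero_add]
      simp only [hcy, add_left_inj, ← Fin.ext_iff, Finset.sum_ite_eq, Finset.mem_univ, if_true]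
    exact ⟨⟨q, hq⟩, Prod.ext (congrArg (toPiece I d) (Subtype.ext heq)) (funext fun i =>
      (congrArg (toPiece J _) (Subtype.ext (hcq i))).trans (hb' i))⟩
  simp only [quotientSeries, map_add, PowerSeries.coeff_mk, Finset.sum_mul, map_sum]
  rw [finrank_eq_of_surjective_of_ker_eq _ g (toPiece_surjective _ d) hsurj hker,
    finrank_prod_of_isDomain, finrank_pi_fin_of_isDomain]
  push_cast
  congr 1
  rw [Fin.sum_univ_eq_sum_range (fun i => (Module.finrank ℤ (gradedPiece J (d - (i + 1))) : ℤ)) m]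
  refine Finset.sum_subset_zero_on_sdiff (Finset.range_subset_range.mpr (min_le_left _ _))
    (fun i hi => ?_) fun i hi => ?_
  · rw [PowerSeries.coeff_X_pow_mul', if_neg]
    simp only [Finset.mem_sdiff, Finset.mem_range, m] at hi
    omega
  · rw [PowerSeries.coeff_X_pow_mul', if_pos, PowerSeries.coeff_mk]
    simp only [Finset.mem_range, m] at hi
    omega

end BlowUp

/-- As `a - b` divides `a ^ d - b ^ d`, two forms may be exchanged inside a power whenever `c` kills
their difference. -/
theorem mul_pow_mem_iff {S : Type*} [CommRing S] {I : Ideal S} {c a b : S}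
    (h : c * (a - b) ∈ I) (d : ℕ) : c * a ^ d ∈ I ↔ c * b ^ d ∈ I := by
  obtain ⟨e, he⟩ := sub_dvd_pow_sub_pow a b d
  have : c * a ^ d - c * b ^ d ∈ I := by
    rw [← mul_sub, he, ← mul_assoc]
    exact I.mul_mem_right _ h
  exact ⟨fun ha => by simpa using sub_mem ha this, fun hb => by simpa using add_mem this hb⟩

/-- The ideal of elements whose product with `c` lies in `I`. -/
def mulColon {S : Type*} [CommRing S] (I : Ideal S) (c : S) : Ideal S :=
  Submodule.comap (LinearMap.mulLeft S c) I

theorem mem_mulColon {S : Type*} [CommRing S] {I : Ideal S} {c j : S} :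
    j ∈ mulColon I c ↔ c * j ∈ I := Iff.rfl

/-! ### The rings of the filtration and the ideals of the centers. -/

section Filtration

variable {L : Type*} [Lattice L] {k : ℕ}

open Classical in
/-- The linear form `∑_{F ≤ v s} x_s`. -/
noncomputable def upForm (v : Fin k → L) (F : L) : MvPolynomial (Fin k) ℤ :=
  ∑ s, if F ≤ v s then X s else 0

/-- The relations of the Chow ring among the variables indexed by `v`. -/
noncomputable def filtIdeal (rk : L → ℕ) (v : Fin k → L) : Ideal (MvPolynomial (Fin k) ℤ) :=
  Ideal.span ({q | ∃ s t, ¬ v s ≤ v t ∧ ¬ v t ≤ v s ∧ q = X s * X t} ∪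
    -- `F` ranges over all of `L`, listed or not; in the last family the form belongs to a listed
    -- element.
    ({q | ∃ s F d, ¬ F ≤ v s ∧ rk (F ⊔ v s) ≤ rk (v s) + d ∧ q = X s * upForm v F ^ d} ∪
    {q | ∃ s d, rk (v s) ≤ d ∧ q = upForm v (v s) ^ d}))

/-- The ideal presenting the Chow ring of `[z, ⊤]` in the variables indexed by `w`. -/
noncomputable def centerIdeal (rk : L → ℕ) (w : Fin k → L) (z : L) :
    Ideal (MvPolynomial (Fin k) ℤ) :=
  filtIdeal rk w ⊔ Ideal.span ({q | ∃ t, ¬ z ≤ w t ∧ q = X t} ∪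
    {q | ∃ G d, z < G ∧ rk G ≤ rk z + d ∧ q = upForm w G ^ d})

theorem upForm_isHomogeneous (v : Fin k → L) (F : L) : (upForm v F).IsHomogeneous 1 := by
  refine IsHomogeneous.sum _ _ _ fun s _ => ?_
  split_ifs
  exacts [isHomogeneous_X ℤ s, isHomogeneous_zero _ _ _]

theorem mul_upForm_sub_mem {v : Fin k → L} {I : Ideal (MvPolynomial (Fin k) ℤ)}
    {c : MvPolynomial (Fin k) ℤ} {F G : L} (hFG : F ≤ G)
    (h : ∀ t, F ≤ v t → ¬ G ≤ v t → c * X t ∈ I) : c * (upForm v F - upForm v G) ∈ I := by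
  rw [upForm, upForm, ← Finset.sum_sub_distrib, Finset.mul_sum]
  refine sum_mem fun t _ => ?_
  by_cases hG : G ≤ v t
  · simp [hG, hFG.trans hG]
  · by_cases hF : F ≤ v t
    · simpa [hG, hF] using h t hF hG
    · simp [hG, hF]

variable {rk : L → ℕ}

theorem quad_mem_filtIdeal {v : Fin k → L} {s t : Fin k} (h₁ : ¬ v s ≤ v t) (h₂ : ¬ v t ≤ v s) :
    X s * X t ∈ filtIdeal rk v :=
  Ideal.subset_span (Or.inl ⟨s, t, h₁, h₂, rfl⟩)

theorem mul_upForm_pow_mem_filtIdeal {v : Fin k → L} {s : Fin k} {F : L} {d : ℕ}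
    (h₁ : ¬ F ≤ v s) (h₂ : rk (F ⊔ v s) ≤ rk (v s) + d) :
    X s * upForm v F ^ d ∈ filtIdeal rk v :=
  Ideal.subset_span (Or.inr (Or.inl ⟨s, F, d, h₁, h₂, rfl⟩))

theorem upForm_pow_mem_filtIdeal {v : Fin k → L} {s : Fin k} {d : ℕ} (h : rk (v s) ≤ d) :
    upForm v (v s) ^ d ∈ filtIdeal rk v :=
  Ideal.subset_span (Or.inr (Or.inr ⟨s, d, h, rfl⟩))

theorem filtIdeal_le_iff {v : Fin k → L} {I : Ideal (MvPolynomial (Fin k) ℤ)} :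
    filtIdeal rk v ≤ I ↔ (∀ s t, ¬ v s ≤ v t → ¬ v t ≤ v s → X s * X t ∈ I) ∧
      (∀ s F d, ¬ F ≤ v s → rk (F ⊔ v s) ≤ rk (v s) + d → X s * upForm v F ^ d ∈ I) ∧
      ∀ s d, rk (v s) ≤ d → upForm v (v s) ^ d ∈ I := by
  rw [filtIdeal, Ideal.span_le, Set.union_subset_iff, Set.union_subset_iff]
  refine and_congr ⟨fun h s t h₁ h₂ => h ⟨s, t, h₁, h₂, rfl⟩, ?_⟩ (and_congr
    ⟨fun h s F d h₁ h₂ => h ⟨s, F, d, h₁, h₂, rfl⟩, ?_⟩ ⟨fun h s d h₁ => h ⟨s, d, h₁, rfl⟩, ?_⟩)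
  · rintro h _ ⟨s, t, h₁, h₂, rfl⟩; exact h s t h₁ h₂
  · rintro h _ ⟨s, F, d, h₁, h₂, rfl⟩; exact h s F d h₁ h₂
  · rintro h _ ⟨s, d, h₁, rfl⟩; exact h s d h₁

theorem centerIdeal_le_iff {w : Fin k → L} {z : L} {I : Ideal (MvPolynomial (Fin k) ℤ)} :
    centerIdeal rk w z ≤ I ↔ filtIdeal rk w ≤ I ∧ (∀ t, ¬ z ≤ w t → X t ∈ I) ∧
      ∀ G d, z < G → rk G ≤ rk z + d → upForm w G ^ d ∈ I := by
  rw [centerIdeal, sup_le_iff, Ideal.span_le, Set.union_subset_iff]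
  refine and_congr Iff.rfl (and_congr ⟨fun h t h₁ => h ⟨t, h₁, rfl⟩, ?_⟩
    ⟨fun h G d h₁ h₂ => h ⟨G, d, h₁, h₂, rfl⟩, ?_⟩)
  · rintro h _ ⟨t, h₁, rfl⟩; exact h t h₁
  · rintro h _ ⟨G, d, h₁, h₂, rfl⟩; exact h G d h₁ h₂

theorem filtIdeal_le_centerIdeal (w : Fin k → L) (z : L) :
    filtIdeal rk w ≤ centerIdeal rk w z := le_sup_left

theorem X_mem_centerIdeal {w : Fin k → L} {z : L} {t : Fin k} (h : ¬ z ≤ w t) :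
    X t ∈ centerIdeal rk w z :=
  Ideal.mem_sup_right (Ideal.subset_span (Or.inl ⟨t, h, rfl⟩))

/-- Only variables above `z` survive, so the forms of `G` and `G ⊔ z` agree modulo the ideal. -/
theorem upForm_pow_mem_centerIdeal {w : Fin k → L} {z G : L} {d : ℕ} (h₁ : ¬ G ≤ z)
    (h₂ : rk (G ⊔ z) ≤ rk z + d) : upForm w G ^ d ∈ centerIdeal rk w z := by
  have h := (mul_pow_mem_iff (c := 1) (I := centerIdeal rk w z)
    (mul_upForm_sub_mem (v := w) (F := G) (G := G ⊔ z) le_sup_left fun t h₁ h₂ => by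
      rw [one_mul]
      exact X_mem_centerIdeal fun h => h₂ (sup_le h₁ h)) d).mpr
  rw [one_mul, one_mul] at h
  exact h (Ideal.mem_sup_right (Ideal.subset_span (Or.inr ⟨G ⊔ z, d, right_lt_sup.mpr h₁, h₂, rfl⟩)))

/-- This makes `truncIdeal` an ideal. A variable not above `z` is handled by submodularity. For `G >
z`, the form of `z` may be exchanged for that of `G` next to `upForm w G ^ d`, and the total
exponent `d + rk z` reaches `rk G`. -/
theorem pow_mul_mem_filtIdeal [Finite L] [IsUpperModularLattice L]
    (hcov : ∀ a b : L, a ⋖ b → rk b = rk a + 1) {w : Fin k → L} {z : L}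
    (hup : ∀ G, z < G → ∃ t, w t = G) :
    ∀ j ∈ centerIdeal rk w z, upForm w z ^ rk z * j ∈ filtIdeal rk w := by
  suffices centerIdeal rk w z ≤ mulColon (filtIdeal rk w) (upForm w z ^ rk z) from
    fun j hj => this hj
  refine centerIdeal_le_iff.mpr ⟨fun j hj => Ideal.mul_mem_left _ _ hj, fun t ht => ?_,
    fun G d hG hd => ?_⟩ <;> rw [mem_mulColon, mul_comm]
  · refine mul_upForm_pow_mem_filtIdeal ht ?_
    have h1 := rank_sup_add_rank_le hcov (inf_le_left : z ⊓ w t ≤ z) (w t)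
    rw [sup_eq_right.mpr (inf_le_right : z ⊓ w t ≤ w t)] at h1
    omega
  · refine (mul_pow_mem_iff (mul_upForm_sub_mem hG.le fun t hz hGt => ?_) (rk z)).mpr ?_
    · rw [mul_comm]
      refine mul_upForm_pow_mem_filtIdeal hGt ?_
      have h1 := rank_sup_add_rank_le hcov hG.le (w t)
      rw [sup_eq_right.mpr hz] at h1
      omega
    · obtain ⟨t, rfl⟩ := hup G hG
      rw [← pow_add]
      exact upForm_pow_mem_filtIdeal (by omega)

end Filtration

/-! ### Adding one variable to the filtration. -/

section Step

variable {L : Type*} [Lattice L] {k : ℕ} (v : Fin (k + 1) → L)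

open Classical in
theorem upForm_succ (F : L) : upForm v F =
    rename Fin.succ (upForm (Fin.tail v) F) + if F ≤ v 0 then X 0 else 0 := by
  rw [upForm, upForm, Fin.sum_univ_succ, add_comm (ite _ _ _), map_sum]
  congr 1
  refine Finset.sum_congr rfl fun s _ => ?_
  by_cases h : F ≤ v s.succ <;> simp [Fin.tail, h]

theorem shiftHom_upForm_of_not_le {F : L} (p : MvPolynomial (Fin k) ℤ) (hF : ¬ F ≤ v 0) :
    shiftHom p (upForm v F) = Polynomial.C (upForm (Fin.tail v) F) := by
  rw [upForm_succ, if_neg hF, add_zero, shiftHom_rename]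

theorem shiftHom_upForm_of_le {F : L} (p : MvPolynomial (Fin k) ℤ) (hF : F ≤ v 0) :
    shiftHom p (upForm v F) =
      Polynomial.C (upForm (Fin.tail v) F) + (Polynomial.X - Polynomial.C p) := by
  rw [upForm_succ, if_pos hF, map_add, shiftHom_rename, shiftHom_X_zero]

theorem shiftHom_X_succ (p : MvPolynomial (Fin k) ℤ) (t : Fin k) :
    shiftHom p (X t.succ) = Polynomial.C (X t) := by
  rw [← shiftHom_rename p (X t), rename_X]

variable {v} {rk : L → ℕ}

theorem filtIdeal_le_comap_truncIdeal (hw : ∀ t, ¬ Fin.tail v t ≤ v 0)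
    (hp : ∀ j ∈ centerIdeal rk (Fin.tail v) (v 0),
      upForm (Fin.tail v) (v 0) ^ rk (v 0) * j ∈ filtIdeal rk (Fin.tail v)) :
    filtIdeal rk v ≤ (truncIdeal _ _ (filtIdeal_le_centerIdeal (Fin.tail v) (v 0)) _ _ hp).comap
      (shiftHom (upForm (Fin.tail v) (v 0))) := by
  refine filtIdeal_le_iff.mpr ⟨fun s t => ?_, fun s F d => ?_, fun s d => ?_⟩
  · refine Fin.cases (fun h₁ h₂ => ?_) (fun s h₁ h₂ => ?_) s <;> revert h₁ h₂ <;>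
      refine Fin.cases (fun h₁ h₂ => ?_) (fun t h₁ h₂ => ?_) t <;> rw [Ideal.mem_comap, map_mul]
    · exact absurd le_rfl h₁
    · rw [shiftHom_X_zero, shiftHom_X_succ]
      exact X_sub_C_mul_C_mem_truncIdeal (X_mem_centerIdeal h₁)
    · rw [shiftHom_X_zero, shiftHom_X_succ, mul_comm]
      exact X_sub_C_mul_C_mem_truncIdeal (X_mem_centerIdeal h₂)
    · rw [shiftHom_X_succ, shiftHom_X_succ, ← Polynomial.C_mul]
      exact C_mem_truncIdeal (quad_mem_filtIdeal h₁ h₂)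
  · refine Fin.cases (fun h₁ h₂ => ?_) (fun s h₁ h₂ => ?_) s <;>
      rw [Ideal.mem_comap, map_mul, map_pow]
    · rw [shiftHom_X_zero, shiftHom_upForm_of_not_le _ _ h₁, ← Polynomial.C_pow]
      exact X_sub_C_mul_C_mem_truncIdeal (upForm_pow_mem_centerIdeal h₁ h₂)
    · rw [shiftHom_X_succ]
      have h : Polynomial.C (X s) * Polynomial.C (upForm (Fin.tail v) F) ^ d ∈
          truncIdeal _ _ (filtIdeal_le_centerIdeal (Fin.tail v) (v 0)) _ _ hp := by
        rw [← Polynomial.C_pow, ← Polynomial.C_mul]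
        exact C_mem_truncIdeal (mul_upForm_pow_mem_filtIdeal h₁ h₂)
      -- If `F ≤ v 0`, the shift adds `y - p` to the form. Here `v 0` is not below the element of
      -- `x_s`, so `x_s ∈ J` and the added term is harmless.
      by_cases hF : F ≤ v 0
      · rw [shiftHom_upForm_of_le _ _ hF]
        refine (mul_pow_mem_iff ?_ d).mpr h
        rw [add_sub_cancel_left, mul_comm]
        exact X_sub_C_mul_C_mem_truncIdeal (X_mem_centerIdeal fun h => h₁ (hF.trans h))
      · rwa [shiftHom_upForm_of_not_le _ _ hF]
  · refine Fin.cases (fun h => ?_) (fun s h => ?_) s <;> rw [Ideal.mem_comap, map_pow]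
    · rw [shiftHom_upForm_of_le _ _ le_rfl, add_sub_cancel]
      exact X_pow_mem_truncIdeal h
    · rw [shiftHom_upForm_of_not_le v (F := v s.succ) _ (hw s), ← Polynomial.C_pow]
      exact C_mem_truncIdeal (upForm_pow_mem_filtIdeal h)

theorem rename_mem_filtIdeal (hw : ∀ t, ¬ Fin.tail v t ≤ v 0) :
    ∀ a ∈ filtIdeal rk (Fin.tail v), rename Fin.succ a ∈ filtIdeal rk v := by
  suffices filtIdeal rk (Fin.tail v) ≤
      (filtIdeal rk v).comap (rename Fin.succ : _ →ₐ[ℤ] MvPolynomial (Fin (k + 1)) ℤ) from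
    fun a ha => this ha
  refine filtIdeal_le_iff.mpr ⟨fun s t h₁ h₂ => ?_, fun s F d h₁ h₂ => ?_, fun s d h => ?_⟩ <;>
    rw [Ideal.mem_comap]
  · rw [map_mul, rename_X, rename_X]
    exact quad_mem_filtIdeal h₁ h₂
  · rw [map_mul, map_pow, rename_X]
    have h : X s.succ * upForm v F ^ d ∈ filtIdeal rk v := mul_upForm_pow_mem_filtIdeal h₁ h₂
    -- The two forms differ by `x₀` only when `F ≤ v 0`; then `v 0` and `v s.succ` are incomparable.
    refine (mul_pow_mem_iff ?_ d).mpr h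
    rw [upForm_succ, sub_add_cancel_left]
    split_ifs with hF
    · rw [mul_neg, neg_mem_iff]
      exact quad_mem_filtIdeal (hw s) fun h => h₁ (hF.trans h)
    · simp
  · have h' := upForm_pow_mem_filtIdeal (rk := rk) (v := v) (s := s.succ) h
    rw [upForm_succ, if_neg (show ¬ v s.succ ≤ v 0 from hw s), add_zero] at h'
    rwa [map_pow]

theorem X_zero_mul_rename_mem_filtIdeal (hw : ∀ t, ¬ Fin.tail v t ≤ v 0) :
    ∀ j ∈ centerIdeal rk (Fin.tail v) (v 0), X 0 * rename Fin.succ j ∈ filtIdeal rk v := by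
  suffices centerIdeal rk (Fin.tail v) (v 0) ≤ (mulColon (filtIdeal rk v) (X 0)).comap
      (rename Fin.succ : _ →ₐ[ℤ] MvPolynomial (Fin (k + 1)) ℤ) from
    fun j hj => mem_mulColon.mp (Ideal.mem_comap.mp (this hj))
  refine centerIdeal_le_iff.mpr ⟨fun a ha => Ideal.mem_comap.mpr (mem_mulColon.mpr
    (Ideal.mul_mem_left _ _ (rename_mem_filtIdeal hw a ha))),
    fun t h => ?_, fun G d h₁ h₂ => ?_⟩ <;>
    rw [Ideal.mem_comap, mem_mulColon]
  · rw [rename_X]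
    exact quad_mem_filtIdeal h (hw t)
  · have h := mul_upForm_pow_mem_filtIdeal (rk := rk) (v := v) (s := 0) (F := G) (d := d)
      h₁.not_ge (by rwa [sup_eq_left.mpr h₁.le])
    rwa [upForm_succ, if_neg h₁.not_ge, add_zero, ← map_pow] at h

/-- Adding one variable to the filtration changes the Hilbert series as a blow-up does. -/
theorem quotientSeries_filtIdeal_succ [Finite L] [IsUpperModularLattice L]
    (hcov : ∀ a b : L, a ⋖ b → rk b = rk a + 1) (hpos : 0 < rk (v 0))
    (hw : ∀ t, ¬ Fin.tail v t ≤ v 0) (hup : ∀ G, v 0 < G → ∃ t, Fin.tail v t = G) :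
    quotientSeries (filtIdeal rk v) = quotientSeries (filtIdeal rk (Fin.tail v)) +
      (∑ i ∈ Finset.range (rk (v 0) - 1), PowerSeries.X ^ (i + 1)) *
        quotientSeries (centerIdeal rk (Fin.tail v) (v 0)) := by
  have hp := pow_mul_mem_filtIdeal hcov hup
  rw [← quotientSeries_comap_truncIdeal (hIJ := filtIdeal_le_centerIdeal _ _) (hpJ := hp) hpos
    (upForm_isHomogeneous _ _)]
  congr 1
  refine le_antisymm (filtIdeal_le_comap_truncIdeal hw hp) (comap_truncIdeal_le
    (rename_mem_filtIdeal hw) (X_zero_mul_rename_mem_filtIdeal hw) ?_)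
  have h := upForm_pow_mem_filtIdeal (rk := rk) (v := v) (s := 0) le_rfl
  rwa [upForm_succ, if_pos le_rfl, add_comm (rename _ _)] at h

end Step

/-! ### The center is the Chow ring of `[z, ⊤]`. -/

section Center

variable {L : Type*} [Lattice L] {k : ℕ} (w : Fin k → L) (z : L)

open Classical in
/-- The homomorphism that keeps the variables of elements above `z` and kills the others. -/
noncomputable def centerHom :
    MvPolynomial (Fin k) ℤ →ₐ[ℤ] MvPolynomial (Var (Set.Ici z)) ℤ :=
  aeval fun t => if h : z < w t then X ⟨⟨w t, h.le⟩, fun h' => h.ne' (congrArg Subtype.val h')⟩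
    else 0

variable {w z}

theorem centerHom_X_of_not_lt {t : Fin k} (h : ¬ z < w t) : centerHom w z (X t) = 0 := by
  rw [centerHom, aeval_X, dif_neg h]

theorem centerHom_X_of_eq {t : Fin k} {Y : Var (Set.Ici z)} (h : w t = Y.1.1) :
    centerHom w z (X t) = X Y := by
  have hz : z < w t := by
    rw [h]
    exact lt_of_le_of_ne Y.1.2 fun h' => Y.2 (Subtype.ext h'.symm)
  rw [centerHom, aeval_X, dif_pos hz]
  congr 1
  exact Subtype.ext (Subtype.ext h)

theorem centerHom_isHomogeneous {q : MvPolynomial (Fin k) ℤ} {d : ℕ} (hq : q.IsHomogeneous d) :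
    (centerHom w z q).IsHomogeneous d := by
  classical
  rw [← one_mul d]
  refine hq.aeval _ fun t => ?_
  split_ifs
  exacts [isHomogeneous_X ℤ _, isHomogeneous_zero _ _ _]

variable {e : Var (Set.Ici z) → Fin k} (he : ∀ Y, w (e Y) = Y.1.1)
include he

theorem centerHom_rename (q : MvPolynomial (Var (Set.Ici z)) ℤ) :
    centerHom w z (rename e q) = q := by
  have : (centerHom w z).comp (rename e) = AlgHom.id ℤ _ := by
    refine MvPolynomial.algHom_ext fun Y => ?_
    rw [AlgHom.comp_apply, rename_X, centerHom_X_of_eq (he Y), AlgHom.id_apply]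
  exact congrArg (fun f => f q) this

theorem exists_eq_of_lt (hinj : Function.Injective w) {t : Fin k} (h : z < w t) :
    ∃ Y, e Y = t :=
  ⟨⟨⟨w t, h.le⟩, fun h' => h.ne' (congrArg Subtype.val h')⟩, hinj (he _)⟩

theorem injective_section : Function.Injective e := fun Y Y' h => by
  refine Subtype.ext (Subtype.ext ?_)
  rw [← he, ← he, h]

theorem centerHom_upForm [Finite L] (hinj : Function.Injective w) (G : L) :
    centerHom w z (upForm w G) = linForm (⟨G ⊔ z, le_sup_right⟩ : Set.Ici z) := by
  rw [upForm, map_sum]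
  symm
  refine Finset.sum_of_injOn e (injective_section he).injOn (fun _ _ => Finset.mem_coe.mpr
    (Finset.mem_univ _)) (fun t _ ht => ?_) fun Y hY => ?_
  · split_ifs with hG
    · by_cases hz : z < w t
      · obtain ⟨Y, rfl⟩ := exists_eq_of_lt he hinj hz
        refine absurd ⟨Y, ?_, rfl⟩ ht
        rw [he] at hG
        exact (Set.toFinite _).coe_toFinset.ge (show G ⊔ z ≤ Y.1.1 from sup_le hG Y.1.2)
      · exact centerHom_X_of_not_lt hz
    · exact map_zero _
  · have : Y ∈ {Y : Var (Set.Ici z) | (⟨G ⊔ z, le_sup_right⟩ : Set.Ici z) ≤ Y.1} :=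
      (Set.Finite.mem_toFinset _).mp hY
    have : G ⊔ z ≤ Y.1.1 := this
    rw [if_pos (by rw [he]; exact le_sup_left.trans this), centerHom_X_of_eq (he Y)]

theorem rename_linForm [Finite L] (hinj : Function.Injective w) {b : Set.Ici z} (hb : b ≠ ⊥) :
    rename e (linForm b) = upForm w b.1 := by
  rw [upForm, linForm, map_sum]
  refine Finset.sum_of_injOn e (injective_section he).injOn (fun _ _ => Finset.mem_coe.mpr
    (Finset.mem_univ _)) (fun t _ ht => ?_) fun Y hY => ?_
  · refine if_neg fun hbt => ht ?_
    have hz : z < b.1 := lt_of_le_of_ne b.2 fun h => hb (Subtype.ext h.symm)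
    obtain ⟨Y, rfl⟩ := exists_eq_of_lt he hinj (hz.trans_le hbt)
    rw [he] at hbt
    exact ⟨Y, by simpa using hbt, rfl⟩
  · rw [rename_X, if_pos]
    rw [he]
    simpa using hY

variable {rk : L → ℕ} [Finite L] (hinj : Function.Injective w)
  (hcov : ∀ a b : L, a ⋖ b → rk b = rk a + 1)
include hinj hcov

theorem rename_mem_centerIdeal {q : MvPolynomial (Var (Set.Ici z)) ℤ}
    (hq : q ∈ chowIdeal (Set.Ici z)) : rename e q ∈ centerIdeal rk w z := by
  suffices chowIdeal (Set.Ici z) ≤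
      (centerIdeal rk w z).comap (rename e : _ →ₐ[ℤ] MvPolynomial (Fin k) ℤ) from this hq
  rw [chowIdeal, sup_le_iff, Ideal.span_le, Ideal.span_le]
  constructor
  · rintro _ ⟨F, G, h₁, h₂, rfl⟩
    rw [SetLike.mem_coe, Ideal.mem_comap, map_mul, rename_X, rename_X]
    refine filtIdeal_le_centerIdeal _ _ (quad_mem_filtIdeal ?_ ?_) <;> rw [he, he]
    exacts [h₁, h₂]
  · rintro _ ⟨b, hb, rfl⟩
    rw [SetLike.mem_coe, Ideal.mem_comap, rename_linForm he hinj hb.1]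
    -- An atom of the interval covers `z`, so exponent `1` is allowed and the linear relation
    -- appears.
    have hzb : z ⋖ b.1 := Ici_covBy_iff.mp (bot_covBy_iff.mpr hb)
    have := upForm_pow_mem_centerIdeal (rk := rk) (w := w) (d := 1) hzb.lt.not_ge
      (by rw [sup_eq_left.mpr hzb.le, hcov _ _ hzb])
    rwa [pow_one] at this

variable [OrderBot L] [IsUpperModularLattice L] [IsAtomistic L]

theorem centerIdeal_le_comap (hw : ∀ t, ¬ w t ≤ z) :
    centerIdeal rk w z ≤ (chowIdeal (Set.Ici z)).comap (centerHom w z) := by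
  have hcov' : ∀ a b : Set.Ici z, a ⋖ b → rk b.1 = rk a.1 + 1 :=
    fun a b h => hcov _ _ (Ici_covBy_iff.mp h)
  have hbot : ∀ G d, ¬ G ≤ z → rk (G ⊔ z) ≤ rk z + d →
      centerHom w z (upForm w G ^ d) ∈ chowIdeal (Set.Ici z) := by
    intro G d hG hd
    -- `Z = ⊥` is the bottom `z` of the interval, where `x_⊥ = 1` leaves a pure power.
    have h := varOrOne_mul_linForm_pow_mem_chowIdeal (rk := fun x : Set.Ici z => rk x.1) hcov' d
      (Z := ⊥) (F := ⟨G ⊔ z, le_sup_right⟩) (fun h => hG (le_sup_left.trans h))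
      (by rw [sup_bot_eq]; exact hd)
    rwa [varOrOne, dif_pos rfl, one_mul, ← centerHom_upForm he hinj, ← map_pow] at h
  refine centerIdeal_le_iff.mpr ⟨filtIdeal_le_iff.mpr ⟨fun s t h₁ h₂ => ?_,
    fun s F d h₁ h₂ => ?_, fun s d h => ?_⟩, fun t ht => ?_, fun G d h₁ h₂ => ?_⟩ <;>
    rw [Ideal.mem_comap]
  · rw [map_mul]
    by_cases hs : z < w s
    · by_cases ht : z < w t
      · obtain ⟨F, rfl⟩ := exists_eq_of_lt he hinj hs
        obtain ⟨G, rfl⟩ := exists_eq_of_lt he hinj ht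
        rw [centerHom_X_of_eq (he F), centerHom_X_of_eq (he G)]
        rw [he, he] at h₁ h₂
        exact quad_mem_chowIdeal h₁ h₂
      · rw [centerHom_X_of_not_lt ht, mul_zero]; exact zero_mem _
    · rw [centerHom_X_of_not_lt hs, zero_mul]; exact zero_mem _
  · rw [map_mul]
    by_cases hs : z < w s
    · obtain ⟨Y, rfl⟩ := exists_eq_of_lt he hinj hs
      rw [he] at h₁ h₂
      have h := varOrOne_mul_linForm_pow_mem_chowIdeal (rk := fun x : Set.Ici z => rk x.1) hcov' d
        (Z := Y.1) (F := ⟨F ⊔ z, le_sup_right⟩) (fun h => h₁ (le_sup_left.trans h)) (by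
          change rk (F ⊔ z ⊔ Y.1.1) ≤ _
          rwa [sup_assoc, sup_eq_right.mpr Y.1.2])
      rwa [varOrOne, dif_neg Y.2, ← centerHom_upForm he hinj, ← centerHom_X_of_eq (he Y),
        ← map_pow] at h
    · rw [centerHom_X_of_not_lt hs, zero_mul]; exact zero_mem _
  · refine hbot _ _ (hw s) ?_
    have h1 := rank_sup_add_rank_le hcov (inf_le_left : w s ⊓ z ≤ w s) z
    rw [sup_eq_right.mpr (inf_le_right : w s ⊓ z ≤ z)] at h1
    omega
  · rw [centerHom_X_of_not_lt fun h => ht h.le]; exact zero_mem _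
  · exact hbot _ _ h₁.not_ge (by rwa [sup_eq_left.mpr h₁.le])

omit he in
theorem quotientSeries_centerIdeal (hw : ∀ t, ¬ w t ≤ z) (hup : ∀ G, z < G → ∃ t, w t = G) :
    quotientSeries (centerIdeal rk w z) = hilbertSeries (Set.Ici z) := by
  choose e he using fun Y : Var (Set.Ici z) => hup Y.1.1
    (lt_of_le_of_ne Y.1.2 fun h => Y.2 (Subtype.ext h.symm))
  rw [hilbertSeries_eq_quotientSeries]
  refine quotientSeries_eq_of_comap (centerHom w z) (fun d q hq => centerHom_isHomogeneous hq)
    (fun d q hq => ⟨rename e q, hq.rename_isHomogeneous, centerHom_rename he q⟩)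
    (le_antisymm (centerIdeal_le_comap he hinj hcov hw) fun q hq => ?_)
  -- Killing the variables not above `z` and renaming back is the identity modulo the center ideal,
  -- so the preimage of the Chow ideal is no larger.
  have h : (Ideal.Quotient.mkₐ ℤ (centerIdeal rk w z)).comp ((rename e).comp (centerHom w z)) =
      Ideal.Quotient.mkₐ ℤ (centerIdeal rk w z) := by
    refine MvPolynomial.algHom_ext fun t => ?_
    rw [AlgHom.comp_apply, AlgHom.comp_apply]
    by_cases ht : z < w t
    · obtain ⟨Y, rfl⟩ := exists_eq_of_lt he hinj ht
      rw [centerHom_X_of_eq (he Y), rename_X]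
    · rw [centerHom_X_of_not_lt ht, map_zero, map_zero]
      refine (Ideal.Quotient.eq_zero_iff_mem.mpr (X_mem_centerIdeal fun h => ?_)).symm
      exact ht (lt_of_le_not_ge h (hw t))
  have h1 := rename_mem_centerIdeal he hinj hcov hq
  rw [← Ideal.Quotient.eq_zero_iff_mem] at h1 ⊢
  rw [← h1]
  exact (congrArg (fun f => f q) h).symm

end Center

/-! ### Invariance under isomorphism, and the base case `ℤ`. -/

section Congr

variable {L L' : Type*} [PartialOrder L] [OrderBot L] [Finite L] [PartialOrder L'] [OrderBot L']
  [Finite L']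

/-- The bijection between variables induced by an isomorphism of posets. -/
def varEquiv (e : L ≃o L') : Var L ≃ Var L' :=
  e.toEquiv.subtypeEquiv fun _ => (map_eq_bot_iff e).not.symm

theorem rename_varEquiv_linForm (e : L ≃o L') (a : L) :
    rename (varEquiv e) (linForm a) = linForm (e a) := by
  rw [linForm, linForm, map_sum]
  refine Finset.sum_equiv (varEquiv e) (fun F => ?_) fun F _ => rename_X _ _
  rw [Set.Finite.mem_toFinset, Set.Finite.mem_toFinset]
  exact (e.le_iff_le (x := a) (y := F.1)).symm

theorem chowIdeal_le_comap_rename (e : L ≃o L') : chowIdeal L ≤ (chowIdeal L').comap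
    (rename (varEquiv e) : _ →ₐ[ℤ] MvPolynomial (Var L') ℤ) := by
  rw [chowIdeal, sup_le_iff, Ideal.span_le, Ideal.span_le]
  constructor
  · rintro _ ⟨F, G, h₁, h₂, rfl⟩
    rw [SetLike.mem_coe, Ideal.mem_comap, map_mul, rename_X, rename_X]
    exact quad_mem_chowIdeal (fun h => h₁ ((e.map_rel_iff (a := F.1) (b := G.1)).mp h))
      fun h => h₂ ((e.map_rel_iff (a := G.1) (b := F.1)).mp h)
  · rintro _ ⟨a, ha, rfl⟩
    rw [SetLike.mem_coe, Ideal.mem_comap, rename_varEquiv_linForm]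
    exact linForm_mem_chowIdeal ((e.isAtom_iff a).mpr ha)

theorem hilbertSeries_congr (e : L ≃o L') : hilbertSeries L = hilbertSeries L' := by
  rw [hilbertSeries_eq_quotientSeries, hilbertSeries_eq_quotientSeries]
  have h : ∀ q : MvPolynomial (Var L) ℤ, rename (varEquiv e.symm) (rename (varEquiv e) q) = q := fun q => by
    rw [rename_rename, show varEquiv e.symm ∘ varEquiv e = id from
      funext (varEquiv e).symm_apply_apply, rename_id_apply]
  have h' : ∀ q : MvPolynomial (Var L') ℤ, rename (varEquiv e) (rename (varEquiv e.symm) q) = q := fun q => by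
    rw [rename_rename, show varEquiv e ∘ varEquiv e.symm = id from
      funext (varEquiv e).apply_symm_apply, rename_id_apply]
  refine quotientSeries_eq_of_comap (rename (varEquiv e))
    (fun d q hq => hq.rename_isHomogeneous)
    (fun d q hq => ⟨rename (varEquiv e.symm) q, hq.rename_isHomogeneous, h' q⟩)
    (le_antisymm (chowIdeal_le_comap_rename e) fun q hq => ?_)
  have := chowIdeal_le_comap_rename e.symm hq
  rwa [Ideal.mem_comap, h] at this

end Congr

theorem quotientSeries_bot_fin_zero :
    quotientSeries (⊥ : Ideal (MvPolynomial (Fin 0) ℤ)) = 1 := by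
  ext d
  rw [quotientSeries, PowerSeries.coeff_mk, PowerSeries.coeff_one]
  split_ifs with hd
  · subst hd
    let f : homogeneousSubmodule (Fin 0) ℤ 0 →ₗ[ℤ] ℤ := lcoeff ℤ 0 ∘ₗ Submodule.subtype _
    rw [← finrank_eq_of_surjective_of_ker_eq f (toPiece ⊥ 0) ?_
      (toPiece_surjective _ _) ?_, Module.finrank_self, Nat.cast_one]
    · intro r
      exact ⟨⟨C r, isHomogeneous_C _ r⟩, coeff_zero_C r⟩
    · ext q
      rw [LinearMap.mem_ker, LinearMap.mem_ker, toPiece_eq_zero_iff, Ideal.mem_bot]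
      change coeff 0 q.1 = 0 ↔ _
      conv_rhs => rw [eq_C_of_isEmpty q.1]
      exact (map_eq_zero_iff C (C_injective _ _)).symm
  · have : Subsingleton (gradedPiece (⊥ : Ideal (MvPolynomial (Fin 0) ℤ)) d) := by
      refine subsingleton_of_forall_eq 0 fun x => ?_
      obtain ⟨q, rfl⟩ := toPiece_surjective _ _ x
      rw [toPiece_eq_zero_iff, Ideal.mem_bot, eq_C_of_isEmpty q.1,
        (show IsHomogeneous q.1 d from q.2).coeff_eq_zero (d := 0) (by simpa using Ne.symm hd),
        C_0]
    rw [Module.finrank_zero_of_subsingleton, Nat.cast_zero]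

/-! ### Summing the blow-up formula over the lattice. -/

section Recursion

variable {L : Type*} [Lattice L] [OrderBot L] [Finite L] [IsUpperModularLattice L] [IsAtomistic L]
  {rk : L → ℕ} (hcov : ∀ a b : L, a ⋖ b → rk b = rk a + 1)
include hcov

/-- Induction on the list. Its hypotheses say that it enumerates an upper set along a linear
extension, and they pass to the tail. -/
theorem quotientSeries_filtIdeal : ∀ {k : ℕ} {v : Fin k → L}, Function.Injective v →
    (∀ s, v s ≠ ⊥) → (∀ s G, v s < G → ∃ t, v t = G) → (∀ s t, v s < v t → s < t) →
    quotientSeries (filtIdeal rk v) = 1 +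
      ∑ s, (∑ i ∈ Finset.range (rk (v s) - 1), PowerSeries.X ^ (i + 1)) *
        hilbertSeries (Set.Ici (v s))
  | 0, v, _, _, _, _ => by
    have : filtIdeal rk v = ⊥ := le_bot_iff.mp (filtIdeal_le_iff.mpr
      ⟨fun s => s.elim0, fun s => s.elim0, fun s => s.elim0⟩)
    rw [this, quotientSeries_bot_fin_zero, Finset.univ_eq_empty, Finset.sum_empty, add_zero]
  | k + 1, v, hinj, hne, hup, hord => by
    have hw : ∀ t, ¬ Fin.tail v t ≤ v 0 := by
      intro t h
      rcases h.eq_or_lt with h | h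
      · exact Fin.succ_ne_zero t (hinj h)
      · exact Fin.not_lt_zero _ (hord _ _ h)
    have hup' : ∀ s G, v s < G → ∃ t, Fin.tail v t = G := by
      intro s G h
      obtain ⟨t, rfl⟩ := hup s G h
      obtain ⟨t', rfl⟩ := Fin.exists_succ_eq.mpr (Fin.pos_iff_ne_zero.mp
        ((Fin.zero_le _).trans_lt (hord _ _ h)))
      exact ⟨t', rfl⟩
    have hinj' : Function.Injective (Fin.tail v) := hinj.comp (Fin.succ_injective k)
    have hpos : 0 < rk (v 0) :=
      (Nat.zero_le _).trans_lt (rank_strictMono hcov (bot_lt_iff_ne_bot.mpr (hne 0)))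
    rw [quotientSeries_filtIdeal_succ hcov hpos hw (hup' 0),
      quotientSeries_filtIdeal hinj' (fun s => hne _) (fun s => hup' _)
        (fun s t h => Fin.succ_lt_succ_iff.mp (hord _ _ h)),
      quotientSeries_centerIdeal hinj' hcov hw (hup' 0), Fin.sum_univ_succ, add_assoc]
    congr 1
    rw [add_comm]
    rfl

/-- No element lies above `z`, so the empty list already presents the interval. -/
theorem hilbertSeries_Ici_isMax {z : L} (hz : IsMax z) : hilbertSeries (Set.Ici z) = 1 := by
  rw [← quotientSeries_centerIdeal (w := (Fin.elim0 : Fin 0 → L)) (fun s => s.elim0) hcov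
    (fun s => s.elim0) fun G h => absurd h hz.not_lt, ← quotientSeries_bot_fin_zero]
  congr 1
  exact le_bot_iff.mp (centerIdeal_le_iff.mpr ⟨filtIdeal_le_iff.mpr
    ⟨fun s => s.elim0, fun s => s.elim0, fun s => s.elim0⟩, fun s => s.elim0,
    fun G d h => absurd h hz.not_lt⟩)

/-- On the full list, the center ideal at `⊥` adds nothing: its powers have exponent at least `rk
G`, and every `G > ⊥` is listed. -/
theorem quotientSeries_filtIdeal_eq_hilbertSeries (h0 : rk ⊥ = 0) {k : ℕ} {v : Fin k → L}
    (hinj : Function.Injective v) (hv : ∀ F, F ≠ ⊥ ↔ ∃ s, v s = F) :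
    quotientSeries (filtIdeal rk v) = hilbertSeries L := by
  have e : Set.Ici (⊥ : L) ≃o L :=
    { toFun := Subtype.val, invFun := fun x => ⟨x, bot_le⟩, left_inv := fun _ => rfl,
      right_inv := fun _ => rfl, map_rel_iff' := Iff.rfl }
  rw [← hilbertSeries_congr e, ← quotientSeries_centerIdeal hinj hcov
    (fun t h => (hv _).mpr ⟨t, rfl⟩ (le_bot_iff.mp h)) fun G h => (hv G).mp h.ne']
  congr 1
  refine le_antisymm (filtIdeal_le_centerIdeal _ _) (centerIdeal_le_iff.mpr ⟨le_rfl,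
    fun t h => absurd bot_le h, fun G d hG hd => ?_⟩)
  obtain ⟨t, rfl⟩ := (hv G).mp hG.ne'
  exact upForm_pow_mem_filtIdeal (by omega)

omit hcov in
theorem exists_linear_enumeration (L : Type*) [PartialOrder L] [OrderBot L] [Finite L] :
    ∃ (k : ℕ) (v : Fin k → L), Function.Injective v ∧ (∀ F, F ≠ ⊥ ↔ ∃ s, v s = F) ∧
      ∀ s t, v s < v t → s < t := by
  have : Finite (LinearExtension (Var L)) := inferInstanceAs (Finite (Var L))
  have := Fintype.ofFinite (LinearExtension (Var L))
  let e := Fintype.orderIsoFinOfCardEq (LinearExtension (Var L)) rfl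
  have hsub : ∀ x : LinearExtension (Var L), ∃ y : Var L, toLinearExtension y = x :=
    fun x => ⟨x, rfl⟩
  refine ⟨_, fun s => (show Var L from e s).1, fun s t h => e.injective (Subtype.ext h),
    fun F => ⟨fun hF => ⟨e.symm (toLinearExtension ⟨F, hF⟩), ?_⟩, ?_⟩, fun s t h => ?_⟩
  · simp only [OrderIso.apply_symm_apply]
    rfl
  · rintro ⟨s, rfl⟩
    exact (show Var L from e s).2
  · refine lt_of_le_of_ne (e.le_iff_le.mp ?_) ?_
    · exact toLinearExtension.monotone (α := Var L) (a := e s) (b := e t) h.le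
    · rintro rfl
      exact h.false

end Recursion

end ChowLattice

/-! ### Grouping by rank. -/

theorem mainTheorem10 {L : Type*} [Lattice L] [BoundedOrder L] [Finite L]
    [IsAtomistic L] [IsUpperModularLattice L] (r : ℕ)
    (hrank : Order.height (⊤ : L) = ((r + 1 : ℕ) : ℕ∞))
    (hupper : ∀ Z Z' : L, Order.height Z = Order.height Z' →
      Nonempty (Set.Ici Z ≃o Set.Ici Z'))
    (Z : ℕ → L) (hZ : ∀ i ∈ Finset.Icc 1 r, Z i ∈ ChowLattice.level L i) :
    ChowLattice.hilbertSeries L =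
      ChowLattice.tNumber (r + 1) +
        PowerSeries.X * ∑ i ∈ Finset.Icc 2 r,
          ((ChowLattice.level L i).ncard : PowerSeries ℤ) * ChowLattice.tNumber (i - 1) *
            ChowLattice.hilbertSeries (Set.Ici (Z i)) := by
  open ChowLattice in
  obtain ⟨rk, hrk, hcov⟩ := exists_rank L
  have hmono := rank_strictMono hcov
  have h0 : rk ⊥ = 0 := by
    have := hrk ⊥
    rw [Order.height_bot] at this
    exact_mod_cast this.symm
  have htop : rk ⊤ = r + 1 := by
    rw [hrk] at hrank
    exact_mod_cast hrank
  have hlevel : ∀ i F, F ∈ level L i ↔ rk F = i := fun i F => by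
    rw [level, Set.mem_ofPred_eq, hrk, Nat.cast_inj]
  have hsum : ∀ m : ℕ, ∑ i ∈ Finset.range m, (PowerSeries.X : PowerSeries ℤ) ^ (i + 1) =
      PowerSeries.X * tNumber m := fun m => by
    rw [tNumber, Finset.mul_sum]
    exact Finset.sum_congr rfl fun i _ => pow_succ' _ _
  obtain ⟨k, v, hinj, hv, hord⟩ := exists_linear_enumeration L
  have hne : ∀ s, v s ≠ ⊥ := fun s => (hv _).mpr ⟨s, rfl⟩
  rw [← quotientSeries_filtIdeal_eq_hilbertSeries hcov h0 hinj hv,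
    quotientSeries_filtIdeal hcov hinj hne
      (fun s G h => (hv G).mp ((bot_le.trans_lt h).ne')) hord,
    ← Finset.sum_fiberwise_of_maps_to (t := Finset.Icc 1 (r + 1)) (g := fun s => rk (v s))
      fun s _ => Finset.mem_Icc.mpr ⟨(Nat.zero_le _).trans_lt
        (hmono (bot_lt_iff_ne_bot.mpr (hne s))), htop ▸ hmono.monotone le_top⟩]
  have hcard : ∀ i, 1 ≤ i → (Finset.univ.filter fun s => rk (v s) = i).card =
      (level L i).ncard := by
    intro i hi
    rw [← Set.ncard_coe_finset, ← Set.ncard_image_of_injective _ hinj]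
    congr 1
    ext F
    rw [hlevel]
    constructor
    · rintro ⟨s, hs, rfl⟩
      simpa using hs
    · rintro rfl
      obtain ⟨s, rfl⟩ := (hv F).mp (by rintro rfl; omega)
      exact ⟨s, by simp, rfl⟩
  have hfiber : ∀ i, 1 ≤ i → ∀ H : PowerSeries ℤ,
      (∀ F : L, rk F = i → hilbertSeries (Set.Ici F) = H) →
      ∑ s with rk (v s) = i, (∑ j ∈ Finset.range (rk (v s) - 1), PowerSeries.X ^ (j + 1)) *
        hilbertSeries (Set.Ici (v s)) =
      PowerSeries.X * (((level L i).ncard : PowerSeries ℤ) * tNumber (i - 1) * H) := by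
    intro i hi H hH
    rw [Finset.sum_congr rfl fun s hs => by
      rw [(Finset.mem_filter.mp hs).2, hH _ (Finset.mem_filter.mp hs).2, hsum],
      Finset.sum_const, hcard i hi, nsmul_eq_mul]
    ring
  have hmax : ∀ F, rk F = r + 1 → F = ⊤ := fun F hF => by
    by_contra h
    have := hmono (lt_top_iff_ne_top.mpr h)
    omega
  -- Rank `r + 1` is split off, where only `⊤` occurs with series `1`; rank `1` is dropped at the
  -- end because `tNumber 0 = 0`.
  rw [Finset.sum_Icc_succ_top (by omega), hfiber (r + 1) (by omega) 1 fun F hF =>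
      hilbertSeries_Ici_isMax hcov (hmax F hF ▸ isMax_top),
    Finset.sum_congr rfl fun i hi => hfiber i (Finset.mem_Icc.mp hi).1 (hilbertSeries (Set.Ici (Z i)))
      fun F hF => hilbertSeries_congr (hupper F (Z i) (by
        rw [hrk, hrk, hF, (hlevel i _).mp (hZ i hi)])).some,
    ← Finset.mul_sum,
    show (level L (r + 1)) = {⊤} from Set.ext fun F => (hlevel _ F).trans
      ⟨hmax F, fun h => by rw [show F = ⊤ from h, htop]⟩, Set.ncard_singleton,
    ← Finset.sum_subset (Finset.Icc_subset_Icc_left (by omega : 1 ≤ 2)) fun i hi hi' => by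
      obtain rfl : i = 1 := by simp only [Finset.mem_Icc] at hi hi'; omega
      simp [tNumber]]
  have ht : tNumber (r + 1) = 1 + PowerSeries.X * tNumber r := by
    rw [← hsum, tNumber, Finset.sum_range_succ', pow_zero, add_comm]
  rw [ht, Nat.add_sub_cancel]
  push_cast
  ring
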